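/- Let $\mathcal F\subseteq\mathbb R^d$ be convex, let $Z\sim P$ take values in an outcome space $\mathcal Z$, and let $\ell:\mathcal F\times\mathcal Z\to\mathbb R$ be a loss such that, for every $z$, $\ell(\cdot,z)$ has diameter $B$, i.e. $|\ell(f,z)-\ell(f',z)|\le B$ for all $f,f'\in\mathcal F$. Assume that all risks $\mathbb E[\ell(f,Z)]$, $f\in\mathcal F$, are finite and that some $f^*\in\mathcal F$ minimizes the risk over $\mathcal F$. For a learning algorithm $\mathcal A$, which maps finite samples to (measurably chosen) elements of $\mathcal F$, for $0<\delta<1$, $K=\lceil\log(2/\delta)\rceil$, and $n\ge1$ divisible by $2K$, ConfidenceBoost is the following procedure. It runs $\mathcal A$ on $K$ independent samples of $n/(2K)$ i.i.d. points from $P$ each, with results $\hat f_1,\dots,\hat f_K$, and then returns a minimizer $\hat f$, over $\{\hat f_1,\dots,\hat f_K\}$, of the empirical risk on a fresh independent sample of $n/2$ i.i.d. points from $P$; ties are broken arbitrarily. There are absolute constants $C_1,C_2>0$ such that the following holds for all such data. (1) Suppose that, for every $z$, $\ell(\cdot,z)$ is $\eta$-exp-concave over $\mathcal F$ with $\eta>0$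 (i.e. $f\mapsto e^{-\eta\ell(f,z)}$ is concave) and $\beta$-smooth over $\mathcal F$ with $\beta\ge1$ (i.e. differentiable with a $\beta$-Lipschitz gradient in the Euclidean norm). Let $\Gamma:\mathcal F\to\mathbb R$ be $1$-strongly convex with diameter $R$, and let $\mathcal A$ return, on every sample $z_1,\dots,z_m$, a minimizer over $\mathcal F$ of $\frac1m\sum_{i=1}^m\ell(f,z_i)+\frac1m\Gamma(f)$. Then, with probability at least $1-\delta$, $$\mathbb E_{Z\sim P}\left[\ell(\hat f,Z)-\ell(f^*,Z)\right]\le C_1\,\frac{\max\{1,\log(1/\delta)\}}{n}\left(\frac{d\beta}{\eta}+dB+R\right).$$ (2) Suppose that $\mathcal Z\subseteq\mathbb R^d\times\mathcal Y$ and $\ell(f,(x,y))=\phi_y(\langle f,x\rangle)$, where, for every $(x,y)\in\mathcal Z$, $\phi_y$ is $\alpha$-strongly convex and $L$-Lipschitz on $\{\langle f,x\rangle:f\in\mathcal F\}$, with $\alpha,L>0$. Put $\eta=\alpha/L^2$ (the loss is then $\eta$-exp-concave). Let $\mathcal A$ return, on every sample, a minimizer of the empirical risk over $\mathcal F$. Then,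 with probability at least $1-\delta$, $$\mathbb E_{Z\sim P}\left[\ell(\hat f,Z)-\ell(f^*,Z)\right]\le C_2\,\frac{\max\{1,\log(1/\delta)\}}{n}\left(\frac{d}{\eta}+B\right).$$ -/

import Mathlib

open MeasureTheory
open scoped NNReal RealInnerProductSpace

/-- Hypotheses are vectors of `ℝ^d` with the Euclidean norm. -/
abbrev Vec (d : ℕ) : Type := EuclideanSpace ℝ (Fin d)

/-- `g` has diameter (at most) `C` over `F`. -/
def HasDiameter {d : ℕ} (F : Set (Vec d)) (g : Vec d → ℝ) (C : ℝ) : Prop :=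
  ∀ f₁ ∈ F, ∀ f₂ ∈ F, |g f₁ - g f₂| ≤ C

/-- `g` is `η`-exp-concave over `F`: `e^{-η g}` is concave over `F`. -/
def ExpConcaveOn {d : ℕ} (F : Set (Vec d)) (η : ℝ) (g : Vec d → ℝ) : Prop :=
  ConcaveOn ℝ F fun f => Real.exp (-η * g f)

/-- `g` is `β`-smooth over `F`: it is differentiable over `F`, with a `β`-Lipschitz gradient.
Derivatives are taken within `F`, since a loss is only defined there; where `F` has nonempty
interior, this is the usual gradient at every interior point. -/
def SmoothOver {d : ℕ} (F : Set (Vec d)) (β : ℝ) (g : Vec d → ℝ) : Prop :=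
  ∃ g' : Vec d → Vec d, (∀ f ∈ F, HasGradientWithinAt g (g' f) F f) ∧
    ∀ f₁ ∈ F, ∀ f₂ ∈ F, ‖g' f₁ - g' f₂‖ ≤ β * ‖f₁ - f₂‖

/-- The risk `E_{Z ∼ P} [ℓ(f, Z)]`. -/
noncomputable def risk {d : ℕ} {Z : Type*} [MeasurableSpace Z] (P : Measure Z)
    (ℓ : Vec d → Z → ℝ) (f : Vec d) : ℝ :=
  ∫ z, ℓ f z ∂P

/-- `f₀` is a risk minimizer over `F`, all of whose elements have a finite risk. -/
structure IsRiskMinimizer {d : ℕ} {Z : Type*} [MeasurableSpace Z] (P : Measure Z)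
    (ℓ : Vec d → Z → ℝ) (F : Set (Vec d)) (f₀ : Vec d) : Prop where
  integrable : ∀ f ∈ F, Integrable (ℓ f) P
  mem : f₀ ∈ F
  le : ∀ f ∈ F, risk P ℓ f₀ ≤ risk P ℓ f

/-- The empirical risk `(1/n) ∑ᵢ ℓ(f, zᵢ)` on the sample `z`. -/
noncomputable def empRisk {d n : ℕ} {Z : Type*} (ℓ : Vec d → Z → ℝ) (z : Fin n → Z)
    (f : Vec d) : ℝ :=
  (1 / (n : ℝ)) * ∑ i, ℓ f (z i)

/-- The empirical risk minimizers over the class `G` on the sample `z`. -/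
def ermSet {d n : ℕ} {Z : Type*} (ℓ : Vec d → Z → ℝ) (G : Set (Vec d)) (z : Fin n → Z) :
    Set (Vec d) :=
  {f | f ∈ G ∧ ∀ g ∈ G, empRisk ℓ z f ≤ empRisk ℓ z g}

/-- A learning algorithm maps samples of any size to hypotheses. -/
abbrev Learner (d : ℕ) (Z : Type*) := (n : ℕ) → (Fin n → Z) → Vec d

/-- `A` is empirical risk minimization over `F` (with any rule for breaking ties). -/
def IsERM {d : ℕ} {Z : Type*} (ℓ : Vec d → Z → ℝ) (F : Set (Vec d)) (A : Learner d Z) : Prop :=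
  ∀ (n : ℕ) (z : Fin n → Z), A n z ∈ ermSet ℓ F z

/-- `A` is empirical risk minimization over `F` with the weighted regularizer `(1/n) Γ`. -/
def IsPenalizedERM {d : ℕ} {Z : Type*} (ℓ : Vec d → Z → ℝ) (Γ : Vec d → ℝ) (F : Set (Vec d))
    (A : Learner d Z) : Prop :=
  ∀ (n : ℕ) (z : Fin n → Z), A n z ∈ F ∧ ∀ f ∈ F,
    empRisk ℓ z (A n z) + (1 / (n : ℝ)) * Γ (A n z) ≤ empRisk ℓ z f + (1 / (n : ℝ)) * Γ f

/-- The possible outputs of ConfidenceBoost (one for each way to break ties in its second phase):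
run `A` on each of the samples `zI 1, …, zI K` of size `nI`, and then run empirical risk
minimization over the finite class of the `K` resulting hypotheses on the sample `zII`. -/
def confidenceBoost {d K nI nII : ℕ} {Z : Type*} (ℓ : Vec d → Z → ℝ) (A : Learner d Z)
    (zI : Fin K → Fin nI → Z) (zII : Fin nII → Z) : Set (Vec d) :=
  ermSet ℓ (Set.range fun j => A nI (zI j)) zII

/-- For `K ≥ 1`, ConfidenceBoost has an output. -/
theorem confidenceBoost_nonempty {d K nI nII : ℕ} {Z : Type*} (hK : 0 < K) (ℓ : Vec d → Z → ℝ)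
    (A : Learner d Z) (zI : Fin K → Fin nI → Z) (zII : Fin nII → Z) :
    (confidenceBoost ℓ A zI zII).Nonempty := by
  have : Nonempty (Fin K) := ⟨⟨0, hK⟩⟩
  obtain ⟨f, hf, hmin⟩ := Set.exists_min_image (Set.range fun j => A nI (zI j))
    (empRisk ℓ zII) (Set.finite_range _) (Set.range_nonempty _)
  exact ⟨f, hf, hmin⟩

/-- The probability that ConfidenceBoost, run with the base learner `A` on independent samples
`zI 1, …, zI K ∼ P^nI` and `zII ∼ P^nII`, may return a hypothesis whose excess risk with respect to
`f₀` exceeds `r`. -/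
noncomputable def boostFailureProb {d : ℕ} {Z : Type*} [MeasurableSpace Z] (P : Measure Z)
    (ℓ : Vec d → Z → ℝ) (A : Learner d Z) (K nI nII : ℕ) (f₀ : Vec d) (r : ℝ) : ENNReal :=
  ((Measure.pi fun _ : Fin K => Measure.pi fun _ : Fin nI => P).prod
      (Measure.pi fun _ : Fin nII => P))
    {s | ∃ f ∈ confidenceBoost ℓ A s.1 s.2, r < risk P ℓ f - risk P ℓ f₀}

/-- The number `K = ⌈log (2/δ)⌉` of runs of the base learner. -/
noncomputable def numRuns (δ : ℝ) : ℕ := ⌈Real.log (2 / δ)⌉₊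

/-- The loss `ℓ_f(x, y) = φ_y(⟨f, x⟩)` on an outcome space of pairs `(x, y)`. -/
noncomputable def linearLoss {d : ℕ} {Y : Type*} {S : Set (Vec d × Y)} (φ : Y → ℝ → ℝ)
    (f : Vec d) (z : S) : ℝ :=
  φ z.1.2 ⟪f, z.1.1⟫

/-- The predictions `⟨f, x⟩`, `f ∈ F`, on the instance `x`. -/
def predictions {d : ℕ} (F : Set (Vec d)) (x : Vec d) : Set ℝ :=
  (fun f : Vec d => ⟪f, x⟫) '' F

/-! The base learner is controlled in expectation by leave-one-out stability, and a Bernstein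
condition turns this into a high-probability bound.

Stability: let `w` minimize the objective on `m + 1` outcomes and `w'` the one without the `j`-th.
Optimality of `w` and curvature of the losses bound a sum over `i` of (Huber-type) squares of linear
forms in `w' - w` by the change at `j` alone. The forms are given by the loss gradients at `w` in
case (1) and by the instances `x i` in case (2). The `j`-th square is at most the leverage score `τ
j` times the sum of squares, so the change at `j` is of order `τ j`, up to trivial losses where `τ
j` is not small. Since the scores total at most `d` (`exists_leverage_scores`), the leave-one-out
regret has a bound `M` independent of `m`, and by exchangeability the expected excess risk is at
most `M / (m + 1)`.

Boosting: comparing the risk minimizer with midpoints gives `E[Y ^ 2] ≤ κ * E[Y]` for excess losses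
`Y` (`IsRiskMinimizer.bernstein`). By Markov, some run is good except with probability `exp (-K)`.
Under the Bernstein condition, empirical means match excess risks up to constant factors and an
additive term of order `κ * log (K / δ) / N`, so the empirical selection of a run costs no more than
that (`measure_boost_failure_le`). -/

/-! ### Leverage scores -/

/-- Finitely many vectors of `ℝ^d` have leverage scores with total at most `d`. -/
theorem exists_leverage_scores {d N : ℕ} (x : Fin N → Vec d) :
    ∃ τ : Fin N → ℝ, (∀ j, 0 ≤ τ j) ∧ ∑ j, τ j ≤ d ∧
      ∀ v j, ⟪x j, v⟫ ^ 2 ≤ τ j * ∑ i, ⟪x i, v⟫ ^ 2 := by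
  let T : Vec d →ₗ[ℝ] EuclideanSpace ℝ (Fin N) :=
    (WithLp.linearEquiv 2 ℝ (Fin N → ℝ)).symm.toLinearMap ∘ₗ
      LinearMap.pi fun i => (innerₗ (Vec d) (x i))
  have hT : ∀ v i, T v i = ⟪x i, v⟫ := fun v i => rfl
  let V := LinearMap.range T
  let b := stdOrthonormalBasis ℝ V
  -- `τ j` is the squared norm of the projection of the `j`-th coordinate vector onto the range `V`
  -- of `T`. The total is `dim V`, and the last bound is Cauchy–Schwarz in `V`.
  refine ⟨fun j => ∑ k, ((b k : V) : EuclideanSpace ℝ (Fin N)) j ^ 2,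
    fun j => Finset.sum_nonneg fun k _ => sq_nonneg _, ?_, fun v j => ?_⟩
  · rw [Finset.sum_comm]
    have h1 : ∀ k, ∑ j, ((b k : V) : EuclideanSpace ℝ (Fin N)) j ^ 2 = 1 := fun k => by
      have h := EuclideanSpace.real_norm_sq_eq ((b k : V) : EuclideanSpace ℝ (Fin N))
      rw [← h, Submodule.norm_coe, b.orthonormal.1 k, one_pow]
    simp only [h1, Finset.sum_const, Finset.card_univ, Fintype.card_fin, nsmul_eq_mul, mul_one]
    have h2 : Module.finrank ℝ V ≤ d := by
      have := LinearMap.finrank_range_le T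
      simpa using this
    exact_mod_cast h2
  · let y : V := ⟨T v, LinearMap.mem_range_self T v⟩
    have hy : ⟪x j, v⟫ = ∑ k, ((b k : V) : EuclideanSpace ℝ (Fin N)) j * ⟪b k, y⟫ := by
      have h := congrArg (fun u : V => (u : EuclideanSpace ℝ (Fin N)) j) (b.sum_repr y)
      simp only [OrthonormalBasis.repr_apply_apply, Submodule.coe_sum, Submodule.coe_smul,
        WithLp.ofLp_sum, WithLp.ofLp_smul, Finset.sum_apply, Pi.smul_apply, smul_eq_mul] at h
      rw [← hT v j]
      refine Eq.trans h.symm (Finset.sum_congr rfl fun k _ => mul_comm _ _)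
    have hn : ∑ i, ⟪x i, v⟫ ^ 2 = ∑ k, ⟪b k, y⟫ ^ 2 := by
      have h1 := EuclideanSpace.real_norm_sq_eq (T v)
      have h2 := b.sum_sq_norm_inner_right y
      simp only [hT] at h1
      rw [← h1]
      simp only [Real.norm_eq_abs, sq_abs] at h2
      rw [h2]
      rfl
    rw [hy, hn]
    exact Finset.sum_mul_sq_le_sq_mul_sq _ _ _

/-! ### Curvature of exp-concave functions along segments -/

/-- With `s = √(1 + y)`, the inequality `log s ≤ s - 1` leaves `(s - 1) ^ 2` on the right. Moreover
`y = (s - 1) * (s + 1)` and `(s + 1) ^ 2 ≤ 2 * s ^ 2 + 2 = 4 + 2 * y`. -/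
theorem sq_div_le_sub_log {y : ℝ} (hy : -1 < y) :
    y ^ 2 / (4 + 2 * |y|) ≤ y - Real.log (1 + y) := by
  have h0 : 0 < 1 + y := by linarith
  set s := √(1 + y) with hs
  have hs0 : 0 < s := Real.sqrt_pos.2 h0
  have hs2 : s ^ 2 = 1 + y := Real.sq_sqrt h0.le
  have hlog : Real.log (1 + y) ≤ 2 * (s - 1) := by
    rw [← hs2, Real.log_pow]
    have := Real.log_le_sub_one_of_pos hs0
    push_cast
    linarith
  have habs := le_abs_self y
  have hy' : y = s ^ 2 - 1 := by linarith
  have h4 : 0 < 4 + 2 * |y| := by positivity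
  have key : y ^ 2 / (4 + 2 * |y|) ≤ (s - 1) ^ 2 := by
    rw [div_le_iff₀ h4]
    have h5 : (s + 1) ^ 2 ≤ 4 + 2 * |y| := by nlinarith [sq_nonneg (s - 1)]
    calc y ^ 2 = (s - 1) ^ 2 * (s + 1) ^ 2 := by rw [hy']; ring
      _ ≤ _ := by gcongr
  nlinarith

theorem segment_mem {d : ℕ} {F : Set (Vec d)} (hF : Convex ℝ F) {w w' : Vec d} (hw : w ∈ F)
    (hw' : w' ∈ F) {t : ℝ} (ht : t ∈ Set.Icc (0 : ℝ) 1) : w + t • (w' - w) ∈ F :=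
  hF.add_smul_sub_mem hw hw' ht

theorem HasGradientWithinAt.hasDerivWithinAt_segment {d : ℕ} {F : Set (Vec d)} (hF : Convex ℝ F)
    {g : Vec d → ℝ} {h w w' : Vec d} (hw : w ∈ F) (hw' : w' ∈ F)
    (hg : HasGradientWithinAt g h F w) :
    HasDerivWithinAt (fun t : ℝ => g (w + t • (w' - w))) ⟪h, w' - w⟫ (Set.Icc 0 1) 0 := by
  have h1 : HasDerivWithinAt (fun t : ℝ => w + t • (w' - w)) (w' - w) (Set.Icc 0 1) 0 := by
    simpa using (((hasDerivAt_id (0 : ℝ)).smul_const (w' - w)).const_add w).hasDerivWithinAt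
  have h2 := hg.hasFDerivWithinAt
  have h3 : HasFDerivWithinAt g (InnerProductSpace.toDual ℝ (Vec d) h) F (w + (0 : ℝ) • (w' - w)) := by
    simpa using h2
  have h4 := h3.comp_hasDerivWithinAt (0 : ℝ) h1 (fun t ht => segment_mem hF hw hw' ht)
  simpa [Function.comp_def] using h4

theorem HasDerivWithinAt.tendsto_div {φ : ℝ → ℝ} {a : ℝ}
    (h : HasDerivWithinAt φ a (Set.Icc 0 1) 0) :
    Filter.Tendsto (fun t => (φ t - φ 0) / t) (nhdsWithin 0 (Set.Ioc 0 1)) (nhds a) := by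
  have h1 := hasDerivWithinAt_iff_tendsto_slope.1 h
  have h2 : Set.Icc (0 : ℝ) 1 \ {0} = Set.Ioc 0 1 := by simp
  rw [h2] at h1
  refine h1.congr fun t => ?_
  rw [slope_def_field, sub_zero]

theorem ExpConcaveOn.exp_le {d : ℕ} {F : Set (Vec d)} {g : Vec d → ℝ} {η : ℝ} {h w w' : Vec d}
    (hc : ExpConcaveOn F η g) (hw : w ∈ F) (hw' : w' ∈ F) (hg : HasGradientWithinAt g h F w) :
    Real.exp (-η * g w') ≤ Real.exp (-η * g w) * (1 - η * ⟪h, w' - w⟫) := by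
  have h1 := ((hg.hasDerivWithinAt_segment hc.1 hw hw').const_mul (-η)).exp
  have h2 := h1.tendsto_div
  have hne : (nhdsWithin (0 : ℝ) (Set.Ioc 0 1)).NeBot := by
    rw [nhdsWithin_Ioc_eq_nhdsGT one_pos]; infer_instance
  have h3 : Real.exp (-η * g w') - Real.exp (-η * g w) ≤
      Real.exp (-η * g (w + (0 : ℝ) • (w' - w))) * (-η * ⟪h, w' - w⟫) := by
    refine ge_of_tendsto h2 (Filter.eventually_of_mem self_mem_nhdsWithin fun t ht => ?_)
    rw [le_div_iff₀ ht.1]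
    have h4 := hc.2 hw hw' (sub_nonneg.2 ht.2) ht.1.le (by ring)
    have h5 : (1 - t) • w + t • w' = w + t • (w' - w) := by module
    simp only [h5, smul_eq_mul] at h4
    simp only [zero_smul, add_zero]
    linarith
  simp only [zero_smul, add_zero] at h3
  linarith

/-- Taking logarithms in the tangent inequality for `exp (-η * g)` gains a Huber-type term,
quadratic for small slopes and linear for large ones. No bound on the gradient or on the diameter is
needed. -/
theorem ExpConcaveOn.le_sub {d : ℕ} {F : Set (Vec d)} {g : Vec d → ℝ} {η : ℝ} {h w w' : Vec d}
    (hη : 0 < η) (hc : ExpConcaveOn F η g) (hw : w ∈ F) (hw' : w' ∈ F)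
    (hg : HasGradientWithinAt g h F w) :
    ⟪h, w' - w⟫ + η * ⟪h, w' - w⟫ ^ 2 / (4 + 2 * η * |⟪h, w' - w⟫|) ≤ g w' - g w := by
  set u := ⟪h, w' - w⟫
  have h1 := hc.exp_le hw hw' hg
  have h2 : Real.exp (-η * (g w' - g w)) ≤ 1 + (-(η * u)) := by
    have : Real.exp (-η * (g w' - g w)) = Real.exp (-η * g w') / Real.exp (-η * g w) := by
      rw [← Real.exp_sub]; ring_nf
    rw [this, div_le_iff₀ (Real.exp_pos _)]
    linarith
  have h3 : -1 < -(η * u) := by linarith [Real.exp_pos (-η * (g w' - g w))]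
  have h4 := sq_div_le_sub_log h3
  have h5 : -η * (g w' - g w) ≤ Real.log (1 + -(η * u)) :=
    (Real.le_log_iff_exp_le (by linarith)).2 h2
  have h6 : (-(η * u)) ^ 2 / (4 + 2 * |-(η * u)|) = η * (η * u ^ 2 / (4 + 2 * η * |u|)) := by
    rw [abs_neg, abs_mul, abs_of_pos hη, mul_div_assoc']
    congr 1 <;> ring
  rw [h6] at h4
  refine le_of_mul_le_mul_left (a := η) ?_ hη
  linarith

/-! ### Leave-one-out regret for exp-concave smooth losses -/

/-- Leave-one-out stability: `w` minimizes the penalized sum of exp-concave losses and `w'` has a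
smaller penalized sum without the `j`-th loss. -/
theorem leaveOneOut_stability {d N : ℕ} {F : Set (Vec d)} {L : Fin N → Vec d → ℝ} {Γ : Vec d → ℝ}
    {η : ℝ} (hη : 0 < η) (hL : ∀ i, ExpConcaveOn F η (L i)) (hΓ : StrongConvexOn F 1 Γ)
    {h : Fin N → Vec d} {w w' : Vec d} (hw : w ∈ F) (hw' : w' ∈ F)
    (hh : ∀ i, HasGradientWithinAt (L i) (h i) F w)
    (hmin : ∀ f ∈ F, ∑ i, L i w + Γ w ≤ ∑ i, L i f + Γ f) (j : Fin N)
    (hle : ∑ i ∈ Finset.univ.erase j, L i w' + Γ w' ≤ ∑ i ∈ Finset.univ.erase j, L i w + Γ w) :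
    1 / 2 * ‖w' - w‖ ^ 2 + ∑ i ∈ Finset.univ.erase j,
      η * ⟪h i, w' - w⟫ ^ 2 / (4 + 2 * η * |⟪h i, w' - w⟫|) ≤ ⟪h j, w' - w⟫ := by
  set v := w' - w with hv
  have hne : (nhdsWithin (0 : ℝ) (Set.Ioc 0 1)).NeBot := by
    rw [nhdsWithin_Ioc_eq_nhdsGT one_pos]; infer_instance
  -- `Γ` need not be differentiable: strong convexity bounds its difference quotient from above by
  -- an expression with a limit as `t → 0`, while the losses contribute their derivatives.
  have hlim : Filter.Tendsto (fun t : ℝ => ∑ i, (L i (w + t • v) - L i (w + (0 : ℝ) • v)) / t +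
      (Γ w' - Γ w - (1 - t) * (1 / 2 * ‖v‖ ^ 2))) (nhdsWithin 0 (Set.Ioc 0 1))
      (nhds (∑ i, ⟪h i, v⟫ + (Γ w' - Γ w - (1 - 0) * (1 / 2 * ‖v‖ ^ 2)))) := by
    refine Filter.Tendsto.add (tendsto_finsetSum _ fun i _ =>
      ((hh i).hasDerivWithinAt_segment hΓ.1 hw hw').tendsto_div) ?_
    refine Filter.Tendsto.mono_left (Continuous.tendsto ?_ 0) nhdsWithin_le_nhds
    fun_prop
  have hfirst : 0 ≤ ∑ i, ⟪h i, v⟫ + (Γ w' - Γ w - (1 - 0) * (1 / 2 * ‖v‖ ^ 2)) := by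
    refine ge_of_tendsto hlim (Filter.eventually_of_mem self_mem_nhdsWithin fun t ht => ?_)
    have h1 := hmin _ (segment_mem hΓ.1 hw hw' ⟨ht.1.le, ht.2⟩)
    have h2 := hΓ.2 hw hw' (sub_nonneg.2 ht.2) ht.1.le (by ring)
    have h5 : (1 - t) • w + t • w' = w + t • v := by rw [hv]; module
    rw [norm_sub_rev w w', ← hv] at h2
    simp only [h5, smul_eq_mul] at h2
    rw [← Finset.sum_div, Finset.sum_sub_distrib]
    simp only [zero_smul, add_zero]
    rw [← hv] at h1
    have h3 : 0 ≤ (∑ i, L i (w + t • v) - ∑ i, L i w) +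
      t * (Γ w' - Γ w - (1 - t) * (1 / 2 * ‖v‖ ^ 2)) := by nlinarith
    have h4 := div_nonneg h3 ht.1.le
    rwa [add_div, mul_div_cancel_left₀ _ ht.1.ne'] at h4
  have hcurv : ∑ i ∈ Finset.univ.erase j, (⟪h i, v⟫ + η * ⟪h i, v⟫ ^ 2 / (4 + 2 * η * |⟪h i, v⟫|)) ≤
      ∑ i ∈ Finset.univ.erase j, (L i w' - L i w) :=
    Finset.sum_le_sum fun i _ => (hL i).le_sub hη hw hw' (hh i)
  rw [Finset.sum_add_distrib, Finset.sum_sub_distrib] at hcurv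
  rw [← Finset.add_sum_erase _ _ (Finset.mem_univ j)] at hfirst
  linarith

/-- A Huber-type curvature bound makes a coordinate with a small leverage score small. -/
theorem le_of_huber_of_leverage {N : ℕ} {u : Fin N → ℝ} {η τ : ℝ} (hη : 0 < η) (j : Fin N)
    (hu : ∑ i ∈ Finset.univ.erase j, η * u i ^ 2 / (4 + 2 * η * |u i|) ≤ u j)
    (hτ : u j ^ 2 ≤ τ * ∑ i, u i ^ 2) (hτ0 : 0 ≤ τ) (hτ1 : τ ≤ 1 / 18) :
    u j ≤ 16 * τ / η := by
  have hterm : ∀ i, 0 ≤ η * u i ^ 2 / (4 + 2 * η * |u i|) := fun i => by positivity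
  have hj : 0 ≤ u j := le_trans (Finset.sum_nonneg fun i _ => hterm i) hu
  -- A single Huber term is at most `u j`, which caps `|u i|`. Hence all denominators are at most `8
  -- + 8 * (η * u j)` and the Huber sum dominates a genuine sum of squares.
  have habs : ∀ i ∈ Finset.univ.erase j, η * |u i| ≤ 2 + 4 * (η * u j) := fun i hi => by
    have h1 : η * u i ^ 2 / (4 + 2 * η * |u i|) ≤ u j :=
      (Finset.single_le_sum (fun i _ => hterm i) hi).trans hu
    rw [div_le_iff₀ (by positivity), ← sq_abs] at h1
    by_contra hc
    push Not at hc
    have hp := abs_nonneg (u i)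
    have h2 : η * |u i| * (η * |u i|) ≤ (η * u j) * (4 + 2 * (η * |u i|)) := by nlinarith
    have h3 : 0 ≤ η * u j := by positivity
    nlinarith
  have hS : ∑ i ∈ Finset.univ.erase j, η * u i ^ 2 ≤ u j * (8 + 8 * (η * u j)) := by
    calc ∑ i ∈ Finset.univ.erase j, η * u i ^ 2
        ≤ ∑ i ∈ Finset.univ.erase j,
          η * u i ^ 2 / (4 + 2 * η * |u i|) * (8 + 8 * (η * u j)) := by
          refine Finset.sum_le_sum fun i hi => ?_
          have hp : 0 < 4 + 2 * η * |u i| := by positivity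
          calc η * u i ^ 2 = η * u i ^ 2 / (4 + 2 * η * |u i|) * (4 + 2 * η * |u i|) := by
                field_simp
            _ ≤ _ := mul_le_mul_of_nonneg_left (by linarith [habs i hi]) (hterm i)
      _ ≤ _ := by
          rw [← Finset.sum_mul]
          exact mul_le_mul_of_nonneg_right hu (by positivity)
  rw [← Finset.mul_sum] at hS
  rw [← Finset.add_sum_erase _ _ (Finset.mem_univ j)] at hτ
  have h1 : η * u j ^ 2 ≤ τ * (η * u j ^ 2 + u j * (8 + 8 * (η * u j))) :=
    calc η * u j ^ 2 ≤ η * (τ * (u j ^ 2 + ∑ i ∈ Finset.univ.erase j, u i ^ 2)) := by gcongr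
      _ = τ * (η * u j ^ 2 + η * ∑ i ∈ Finset.univ.erase j, u i ^ 2) := by ring
      _ ≤ _ := by gcongr
  rw [le_div_iff₀ hη]
  rcases hj.eq_or_lt with h0 | h0
  · rw [← h0]; linarith
  · have h2 : η * u j ≤ τ * (8 + 9 * (η * u j)) := by
      refine le_of_mul_le_mul_left (a := u j) ?_ h0
      linarith
    have h3 : 0 ≤ η * u j := by positivity
    nlinarith

/-- For small `τ`, convexity at `w'` bounds the change by `⟪h', w' - w⟫`. Smoothness moves this
gradient to `w` at the price `β * ‖w' - w‖ ^ 2`, which strong convexity of `Γ` bounds by `2 * β * ⟪h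
j, w' - w⟫`; the total is at most `3 * β * ⟪h j, w' - w⟫`. For `τ > 1 / 18`, the diameter gives `B ≤
18 * B * τ`. -/
theorem leaveOneOut_loss_le {d N : ℕ} {F : Set (Vec d)} {L : Fin N → Vec d → ℝ} {Γ : Vec d → ℝ}
    {η β B τ : ℝ} (hη : 0 < η) (hβ : 1 ≤ β) (hL : ∀ i, ExpConcaveOn F η (L i))
    (hΓ : StrongConvexOn F 1 Γ)
    {h : Fin N → Vec d} {w w' : Vec d} (hw : w ∈ F) (hw' : w' ∈ F)
    (hh : ∀ i, HasGradientWithinAt (L i) (h i) F w)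
    (hmin : ∀ f ∈ F, ∑ i, L i w + Γ w ≤ ∑ i, L i f + Γ f) (j : Fin N)
    (hle : ∑ i ∈ Finset.univ.erase j, L i w' + Γ w' ≤ ∑ i ∈ Finset.univ.erase j, L i w + Γ w)
    {h' : Vec d} (hh' : HasGradientWithinAt (L j) h' F w') (hsmooth : ‖h' - h j‖ ≤ β * ‖w' - w‖)
    (hB : |L j w' - L j w| ≤ B) (hτ0 : 0 ≤ τ)
    (hτ : ⟪h j, w' - w⟫ ^ 2 ≤ τ * ∑ i, ⟪h i, w' - w⟫ ^ 2) :
    L j w' - L j w ≤ (48 * β / η + 18 * B) * τ := by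
  have hstab := leaveOneOut_stability hη hL hΓ hw hw' hh hmin j hle
  have hB0 : 0 ≤ B := (abs_nonneg _).trans hB
  have hc : 0 ≤ 48 * β / η := by positivity
  rcases le_or_gt τ (1 / 18) with hτ1 | hτ1
  · have hu := le_of_huber_of_leverage (u := fun i => ⟪h i, w' - w⟫) hη j
      (by nlinarith [sq_nonneg ‖w' - w‖]) hτ hτ0 hτ1
    have hsum : 0 ≤ ∑ i ∈ Finset.univ.erase j,
        η * ⟪h i, w' - w⟫ ^ 2 / (4 + 2 * η * |⟪h i, w' - w⟫|) :=
      Finset.sum_nonneg fun i _ => by positivity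
    have h1 := (hL j).le_sub hη hw' hw hh'
    have h2 : 0 ≤ η * ⟪h', w - w'⟫ ^ 2 / (4 + 2 * η * |⟪h', w - w'⟫|) := by positivity
    have h3 : ⟪h', w - w'⟫ = -⟪h j, w' - w⟫ - ⟪h' - h j, w' - w⟫ := by
      rw [inner_sub_left, ← neg_sub w' w, inner_neg_right]; ring
    have h4 : ⟪h' - h j, w' - w⟫ ≤ β * ‖w' - w‖ ^ 2 := by
      calc ⟪h' - h j, w' - w⟫ ≤ ‖h' - h j‖ * ‖w' - w‖ := real_inner_le_norm _ _
        _ ≤ β * ‖w' - w‖ * ‖w' - w‖ := by gcongr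
        _ = _ := by ring
    have h5 : ‖w' - w‖ ^ 2 ≤ 2 * ⟪h j, w' - w⟫ := by linarith
    have h6 : 0 ≤ ⟪h j, w' - w⟫ := by nlinarith [sq_nonneg ‖w' - w‖]
    have h7 : L j w' - L j w ≤ 3 * β * ⟪h j, w' - w⟫ := by nlinarith
    calc L j w' - L j w ≤ 3 * β * (16 * τ / η) := h7.trans (by gcongr)
      _ = 48 * β / η * τ := by ring
      _ ≤ _ := by nlinarith
  · have := le_of_abs_le hB
    nlinarith

theorem IsPenalizedERM.sum_le {d m : ℕ} {Z : Type*} {ℓ : Vec d → Z → ℝ} {Γ : Vec d → ℝ}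
    {F : Set (Vec d)} {A : Learner d Z} (hA : IsPenalizedERM ℓ Γ F A) (hm : 0 < m) (z : Fin m → Z)
    {f : Vec d} (hf : f ∈ F) :
    ∑ i, ℓ (A m z) (z i) + Γ (A m z) ≤ ∑ i, ℓ f (z i) + Γ f := by
  have h := (hA m z).2 f hf
  have hm' : (0 : ℝ) < 1 / m := by positivity
  rw [empRisk, empRisk, ← mul_add, ← mul_add] at h
  exact le_of_mul_le_mul_left h hm'

theorem IsERM.sum_le {d m : ℕ} {Z : Type*} {ℓ : Vec d → Z → ℝ}
    {F : Set (Vec d)} {A : Learner d Z} (hA : IsERM ℓ F A) (hm : 0 < m) (z : Fin m → Z)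
    {f : Vec d} (hf : f ∈ F) :
    ∑ i, ℓ (A m z) (z i) ≤ ∑ i, ℓ f (z i) := by
  have h := (hA m z).2 f hf
  have hm' : (0 : ℝ) < 1 / m := by positivity
  exact le_of_mul_le_mul_left h hm'

theorem sum_erase_eq_sum_succAbove {m : ℕ} (g : Fin (m + 1) → ℝ) (j : Fin (m + 1)) :
    ∑ i ∈ Finset.univ.erase j, g i = ∑ i, g (j.succAbove i) := by
  have h1 := Finset.add_sum_erase Finset.univ g (Finset.mem_univ j)
  have h2 := Fin.sum_univ_succAbove g j
  linarith

/-- The leave-one-out regret of penalized empirical risk minimization, for exp-concave and smooth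
losses. -/
theorem IsPenalizedERM.leaveOneOut_regret_le {d m : ℕ} {Z : Type*} {ℓ : Vec d → Z → ℝ}
    {Γ : Vec d → ℝ} {F : Set (Vec d)} {A : Learner d Z} {η β B R : ℝ}
    (hA : IsPenalizedERM ℓ Γ F A) (hη : 0 < η) (hβ : 1 ≤ β)
    (hexp : ∀ z, ExpConcaveOn F η fun f => ℓ f z)
    (hB : ∀ z, HasDiameter F (fun f => ℓ f z) B)
    (hsmooth : ∀ z, SmoothOver F β fun f => ℓ f z)
    (hΓ : StrongConvexOn F 1 Γ) (hR : HasDiameter F Γ R) (hm : 0 < m) (z : Fin (m + 1) → Z)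
    {f : Vec d} (hf : f ∈ F) :
    ∑ j, (ℓ (A m fun i => z (j.succAbove i)) (z j) - ℓ f (z j)) ≤
      48 * d * β / η + 18 * d * B + R := by
  choose g' hg' hLip using hsmooth
  set w := A (m + 1) z
  have hw : w ∈ F := (hA _ z).1
  -- All gradients are taken at the full-sample minimizer `w`, so one family of scores serves every
  -- `j`.
  obtain ⟨τ, hτ0, hτd, hτ⟩ := exists_leverage_scores fun i => g' (z i) w
  have hloss : ∀ j, ℓ (A m fun i => z (j.succAbove i)) (z j) - ℓ w (z j) ≤
      (48 * β / η + 18 * B) * τ j := fun j => by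
    have hw' := (hA m fun i => z (j.succAbove i)).1
    refine leaveOneOut_loss_le (L := fun i f => ℓ f (z i)) hη hβ (fun i => hexp (z i)) hΓ hw hw'
      (fun i => hg' (z i) w hw) (fun f hf => hA.sum_le m.succ_pos z hf) j ?_
      (hg' (z j) _ hw') (hLip _ _ hw' _ hw) (hB _ _ hw' _ hw) (hτ0 j) (hτ _ j)
    rw [sum_erase_eq_sum_succAbove, sum_erase_eq_sum_succAbove]
    exact hA.sum_le hm _ hw
  have hsum := Finset.sum_le_sum fun j (_ : j ∈ Finset.univ) => hloss j
  rw [← Finset.mul_sum, Finset.sum_sub_distrib] at hsum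
  have hB0 : 0 ≤ B := (abs_nonneg _).trans (hB (z 0) _ hw _ hw)
  have hmul : (48 * β / η + 18 * B) * ∑ j, τ j ≤ (48 * β / η + 18 * B) * d := by gcongr
  have h1 := hA.sum_le m.succ_pos z hf
  have h2 := (le_abs_self _).trans (hR f hf w hw)
  rw [Finset.sum_sub_distrib]
  have h3 : (48 * β / η + 18 * B) * d = 48 * d * β / η + 18 * d * B := by ring
  linarith

/-! ### Leave-one-out regret for strongly convex losses of linear predictions -/

theorem midpoint_mem_of_convex {d : ℕ} {F : Set (Vec d)} (hF : Convex ℝ F) {w w' : Vec d}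
    (hw : w ∈ F) (hw' : w' ∈ F) : (1 / 2 : ℝ) • w + (1 / 2 : ℝ) • w' ∈ F :=
  hF hw hw' (by norm_num) (by norm_num) (by norm_num)

theorem linearLoss_midpoint_le {d : ℕ} {Y : Type*} {S : Set (Vec d × Y)} {F : Set (Vec d)}
    {φ : Y → ℝ → ℝ} {α : ℝ} {z : S} (hsc : StrongConvexOn (predictions F z.1.1) α (φ z.1.2))
    {w w' : Vec d} (hw : w ∈ F) (hw' : w' ∈ F) :
    linearLoss φ ((1 / 2 : ℝ) • w + (1 / 2 : ℝ) • w') z ≤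
      1 / 2 * (linearLoss φ w z + linearLoss φ w' z) - α / 8 * ⟪z.1.1, w' - w⟫ ^ 2 := by
  have h := hsc.2 (Set.mem_image_of_mem _ hw) (Set.mem_image_of_mem _ hw')
    (by norm_num : (0 : ℝ) ≤ 1 / 2) (by norm_num : (0 : ℝ) ≤ 1 / 2) (by norm_num)
  have h1 : ⟪z.1.1, w' - w⟫ = ⟪w', z.1.1⟫ - ⟪w, z.1.1⟫ := by
    rw [inner_sub_right, real_inner_comm, real_inner_comm w]
  simp only [linearLoss, inner_add_left, real_inner_smul_left]
  simp only [smul_eq_mul, Real.norm_eq_abs, sq_abs] at h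
  rw [h1]
  linarith

theorem linearLoss_sub_sq_le {d : ℕ} {Y : Type*} {S : Set (Vec d × Y)} {F : Set (Vec d)}
    {φ : Y → ℝ → ℝ} {L : ℝ≥0} {z : S} (hLip : LipschitzOnWith L (φ z.1.2) (predictions F z.1.1))
    {w w' : Vec d} (hw : w ∈ F) (hw' : w' ∈ F) :
    (linearLoss φ w' z - linearLoss φ w z) ^ 2 ≤ L ^ 2 * ⟪z.1.1, w' - w⟫ ^ 2 := by
  have h := hLip.dist_le_mul _ (Set.mem_image_of_mem _ hw') _ (Set.mem_image_of_mem _ hw)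
  have h1 : ⟪z.1.1, w' - w⟫ = ⟪w', z.1.1⟫ - ⟪w, z.1.1⟫ := by
    rw [inner_sub_right, real_inner_comm, real_inner_comm w]
  rw [Real.dist_eq, Real.dist_eq] at h
  rw [h1, ← sq_abs, ← sq_abs (⟪w', z.1.1⟫ - ⟪w, z.1.1⟫), ← mul_pow]
  exact pow_le_pow_left₀ (abs_nonneg _) h 2

/-- The leave-one-out regret of empirical risk minimization, for strongly convex and Lipschitz
losses of linear predictions. -/
theorem IsERM.leaveOneOut_regret_le {d m : ℕ} {Y : Type*} {S : Set (Vec d × Y)} {F : Set (Vec d)}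
    {φ : Y → ℝ → ℝ} {α : ℝ} {L : ℝ≥0} {A : Learner d S}
    (hA : IsERM (linearLoss φ) F A) (hF : Convex ℝ F) (hα : 0 < α)
    (hsc : ∀ z : S, StrongConvexOn (predictions F z.1.1) α (φ z.1.2))
    (hLip : ∀ z : S, LipschitzOnWith L (φ z.1.2) (predictions F z.1.1))
    (hm : 0 < m) (z : Fin (m + 1) → S) {f : Vec d} (hf : f ∈ F) :
    ∑ j, (linearLoss φ (A m fun i => z (j.succAbove i)) (z j) - linearLoss φ f (z j)) ≤
      4 * d * (L ^ 2 / α) := by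
  set w := A (m + 1) z
  have hw : w ∈ F := (hA _ z).1
  obtain ⟨τ, hτ0, hτd, hτ⟩ := exists_leverage_scores fun i => (z i).1.1
  have hloss : ∀ j, linearLoss φ (A m fun i => z (j.succAbove i)) (z j) - linearLoss φ w (z j) ≤
      4 * (L ^ 2 / α) * τ j := fun j => by
    set w' := A m fun i => z (j.succAbove i)
    have hw' : w' ∈ F := (hA m fun i => z (j.succAbove i)).1
    have hloo : ∑ i ∈ Finset.univ.erase j, linearLoss φ w' (z i) ≤
        ∑ i ∈ Finset.univ.erase j, linearLoss φ w (z i) := by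
      rw [sum_erase_eq_sum_succAbove (fun i => linearLoss φ w' (z i)),
        sum_erase_eq_sum_succAbove (fun i => linearLoss φ w (z i))]
      exact hA.sum_le hm _ hw
    have h1 := hA.sum_le m.succ_pos z (midpoint_mem_of_convex hF hw hw')
    have h2 := Finset.sum_le_sum fun i (_ : i ∈ Finset.univ) =>
      linearLoss_midpoint_le (hsc (z i)) hw hw'
    rw [Finset.sum_sub_distrib, ← Finset.mul_sum, ← Finset.mul_sum, Finset.sum_add_distrib] at h2
    have h3 := Finset.add_sum_erase Finset.univ (fun i => linearLoss φ w' (z i)) (Finset.mem_univ j)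
    have h4 := Finset.add_sum_erase Finset.univ (fun i => linearLoss φ w (z i)) (Finset.mem_univ j)
    set Δ := linearLoss φ w' (z j) - linearLoss φ w (z j) with hΔ
    have h5 : Δ ^ 2 ≤ L ^ 2 * ⟪(z j).1.1, w' - w⟫ ^ 2 := linearLoss_sub_sq_le (hLip (z j)) hw hw'
    have h6 := hτ (w' - w) j
    set Q := ∑ i, ⟪(z i).1.1, w' - w⟫ ^ 2
    -- The midpoint of `w` and `w'` does not beat `w`, and `w'` is no worse than `w` off the `j`-th
    -- outcome, so the strong convexity gain is paid by the `j`-th loss. With `Δ ^ 2 ≤ L ^ 2 * τ j *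
    -- Q`, dividing by `Δ` gives the bound.
    have h7 : α / 4 * Q ≤ Δ := by
      change ∑ i, linearLoss φ w (z i) ≤ _ at h1
      linarith
    have hQ : 0 ≤ Q := Finset.sum_nonneg fun i _ => sq_nonneg _
    have h8 : Δ ^ 2 ≤ L ^ 2 * (τ j * (4 / α * Δ)) := by
      have : Q ≤ 4 / α * Δ := by
        rw [div_mul_eq_mul_div, le_div_iff₀ hα]; linarith
      calc Δ ^ 2 ≤ L ^ 2 * (τ j * Q) := h5.trans (by gcongr)
        _ ≤ _ := by have := hτ0 j; gcongr
    have h9 : 0 ≤ Δ := le_trans (by positivity) h7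
    rcases h9.eq_or_lt with h0 | h0
    · rw [← h0]; have := hτ0 j; positivity
    · refine le_of_mul_le_mul_left (a := Δ) ?_ h0
      calc Δ * Δ = Δ ^ 2 := by ring
        _ ≤ _ := h8
        _ = _ := by ring
  have hsum := Finset.sum_le_sum fun j (_ : j ∈ Finset.univ) => hloss j
  rw [← Finset.mul_sum, Finset.sum_sub_distrib] at hsum
  have hmul : 4 * (L ^ 2 / α) * ∑ j, τ j ≤ 4 * (L ^ 2 / α) * d := by gcongr
  have h1 := hA.sum_le m.succ_pos z hf
  rw [Finset.sum_sub_distrib]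
  have h3 : 4 * ((L : ℝ) ^ 2 / α) * d = 4 * d * (L ^ 2 / α) := by ring
  linarith

/-! ### Expected excess risk and confidence boosting -/

section Expectation

variable {H Z : Type*} [MeasurableSpace H] [MeasurableSpace Z] {P : Measure Z}
  [IsProbabilityMeasure P] {Y : H → Z → ℝ} {B : ℝ}

theorem Measurable.integrable_of_abs_le {Ω : Type*} [MeasurableSpace Ω] {μ : Measure Ω}
    [IsFiniteMeasure μ] {g : Ω → ℝ} {C : ℝ} (hg : Measurable g) (hC : ∀ ω, |g ω| ≤ C) :
    Integrable g μ :=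
  Integrable.of_bound hg.aestronglyMeasurable C (Filter.Eventually.of_forall hC)

/-- A bound on the leave-one-out sums bounds the expected value at a fresh outcome. -/
theorem integral_integral_le_of_leaveOneOut (hY : Measurable (Function.uncurry Y))
    (hB : ∀ h z, |Y h z| ≤ B) {m : ℕ} {a : (Fin m → Z) → H} (ha : Measurable a) {M : ℝ}
    (hM : ∀ z : Fin (m + 1) → Z, ∑ j, Y (a fun i => z (j.succAbove i)) (z j) ≤ M) :
    ∫ S, ∫ z, Y (a S) z ∂P ∂(Measure.pi fun _ : Fin m => P) ≤ M / (m + 1) := by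
  have hYa : Measurable fun p : Z × (Fin m → Z) => Y (a p.2) p.1 :=
    hY.comp ((ha.comp measurable_snd).prodMk measurable_fst)
  -- The held-out outcome is independent of the others, so every leave-one-out term has the
  -- expectation of a fresh test loss.
  have hj : ∀ j : Fin (m + 1), ∫ z : Fin (m + 1) → Z, Y (a fun i => z (j.succAbove i)) (z j)
      ∂(Measure.pi fun _ => P) = ∫ S, ∫ z, Y (a S) z ∂P ∂(Measure.pi fun _ : Fin m => P) := by
    intro j
    have h1 := (measurePreserving_piFinSuccAbove (fun _ : Fin (m + 1) => P) j).integral_comp'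
      (fun p : Z × (Fin m → Z) => Y (a p.2) p.1)
    rw [integral_prod_symm _ (hYa.integrable_of_abs_le fun p => hB _ _)] at h1
    exact h1
  have hint : ∀ j : Fin (m + 1), Integrable
      (fun z : Fin (m + 1) → Z => Y (a fun i => z (j.succAbove i)) (z j))
      (Measure.pi fun _ => P) := fun j =>
    (hY.comp ((ha.comp (measurable_pi_lambda _ fun i => measurable_pi_apply _)).prodMk
      (measurable_pi_apply j))).integrable_of_abs_le fun z => hB _ _
  have h2 : ∫ z : Fin (m + 1) → Z, ∑ j, Y (a fun i => z (j.succAbove i)) (z j)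
      ∂(Measure.pi fun _ => P) ≤ ∫ _, M ∂(Measure.pi fun _ : Fin (m + 1) => P) :=
    integral_mono (integrable_finsetSum _ fun j _ => hint j) (integrable_const _) hM
  rw [integral_finsetSum _ fun j _ => hint j, integral_const] at h2
  simp only [hj, Finset.sum_const, Finset.card_univ, Fintype.card_fin, nsmul_eq_mul,
    probReal_univ, one_smul] at h2
  rw [le_div_iff₀ (by positivity)]
  push_cast at h2
  linarith

theorem measurable_integral_right (hY : Measurable (Function.uncurry Y)) :
    Measurable fun h => ∫ z, Y h z ∂P :=
  (hY.stronglyMeasurable.integral_prod_right (ν := P)).measurable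

/-- Markov's inequality on `K` independent runs. -/
theorem measure_forall_lt_le {Ω : Type*} [MeasurableSpace Ω] {μ : Measure Ω}
    [IsProbabilityMeasure μ] {ρ : Ω → ℝ} (hint : Integrable ρ μ) (hρ : ∀ ω, 0 ≤ ρ ω) {ε : ℝ}
    (hε : 0 < ε) (hle : ∫ ω, ρ ω ∂μ ≤ ε) (K : ℕ) :
    (Measure.pi fun _ : Fin K => μ) {ω | ∀ k, Real.exp 1 * ε < ρ (ω k)} ≤
      ENNReal.ofReal (Real.exp (-K)) := by
  have h1 := mul_meas_ge_le_integral_of_nonneg (Filter.Eventually.of_forall hρ) hint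
    (Real.exp 1 * ε)
  have h2 : μ.real {ω | Real.exp 1 * ε ≤ ρ ω} ≤ Real.exp (-1) := by
    have h3 : Real.exp 1 * μ.real {ω | Real.exp 1 * ε ≤ ρ ω} ≤ 1 := by
      refine le_of_mul_le_mul_left (a := ε) ?_ hε
      calc _ = Real.exp 1 * ε * μ.real {ω | Real.exp 1 * ε ≤ ρ ω} := by ring
        _ ≤ ε * 1 := by linarith
    rw [Real.exp_neg, ← one_div, le_div_iff₀ (Real.exp_pos _)]
    linarith
  have h4 : μ {ω | Real.exp 1 * ε < ρ ω} ≤ ENNReal.ofReal (Real.exp (-1)) := by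
    refine (measure_mono (t := {ω | Real.exp 1 * ε ≤ ρ ω})
      fun ω (hω : Real.exp 1 * ε < ρ ω) => hω.le).trans ?_
    rw [← ofReal_measureReal]
    exact ENNReal.ofReal_le_ofReal h2
  have h5 : {ω : Fin K → Ω | ∀ k, Real.exp 1 * ε < ρ (ω k)} =
      Set.univ.pi fun _ => {ω | Real.exp 1 * ε < ρ ω} := by
    ext; simp
  rw [h5, Measure.pi_pi, Finset.prod_const, Finset.card_univ, Fintype.card_fin]
  calc _ ≤ ENNReal.ofReal (Real.exp (-1)) ^ K := by gcongr
    _ = _ := by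
      rw [← ENNReal.ofReal_pow (Real.exp_pos _).le, ← Real.exp_nat_mul]
      congr 2; ring

/-- This integrates `exp x ≤ 1 + x + x ^ 2`, valid for `|x| ≤ 1`, and then uses `1 + x ≤ exp x`. -/
theorem integral_exp_le {g : Z → ℝ} (hg : Measurable g) (hB : ∀ z, |g z| ≤ B) {c : ℝ}
    (hc : |c| * B ≤ 1) :
    ∫ z, Real.exp (c * g z) ∂P ≤ Real.exp (c * ∫ z, g z ∂P + c ^ 2 * ∫ z, g z ^ 2 ∂P) := by
  have hcg : ∀ z, |c * g z| ≤ 1 := fun z => by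
    rw [abs_mul]
    exact (mul_le_mul_of_nonneg_left (hB z) (abs_nonneg c)).trans hc
  have hi1 : Integrable g P := hg.integrable_of_abs_le hB
  have hi2 : Integrable (fun z => g z ^ 2) P :=
    (hg.pow_const 2).integrable_of_abs_le (C := B ^ 2) fun z => by
      rw [abs_pow]; exact pow_le_pow_left₀ (abs_nonneg _) (hB z) 2
  have hi3 : Integrable (fun z => Real.exp (c * g z)) P :=
    (hg.const_mul c).exp.integrable_of_abs_le (C := Real.exp 1) fun z => by
      rw [abs_of_pos (Real.exp_pos _)]
      exact Real.exp_le_exp.2 (le_of_abs_le (hcg z))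
  have hi4 : Integrable (fun z => c * g z + c ^ 2 * g z ^ 2) P :=
    (hi1.const_mul c).add (hi2.const_mul _)
  calc ∫ z, Real.exp (c * g z) ∂P ≤ ∫ z, (c * g z + c ^ 2 * g z ^ 2) + 1 ∂P := by
        refine integral_mono hi3 (hi4.add (integrable_const _)) fun z => ?_
        have := le_of_abs_le (Real.abs_exp_sub_one_sub_id_le (hcg z))
        rw [mul_pow] at this
        change Real.exp (c * g z) ≤ (c * g z + c ^ 2 * g z ^ 2) + 1
        linarith
    _ = (c * ∫ z, g z ∂P + c ^ 2 * ∫ z, g z ^ 2 ∂P) + 1 := by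
        rw [integral_add hi4 (integrable_const _), integral_add (hi1.const_mul c) (hi2.const_mul _),
          integral_const_mul, integral_const_mul, integral_const]
        simp
    _ ≤ _ := Real.add_one_le_exp _

/-- Chernoff's bound for sums of independent copies. -/
theorem measure_pi_sum_ge_le {g : Z → ℝ} {b : ℝ}
    (hi : Integrable (fun z => Real.exp (g z)) P) (hb : ∫ z, Real.exp (g z) ∂P ≤ Real.exp b)
    (N : ℕ) (s : ℝ) :
    (Measure.pi fun _ : Fin N => P) {z | s + N * b ≤ ∑ i, g (z i)} ≤
      ENNReal.ofReal (Real.exp (-s)) := by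
  set μ := Measure.pi fun _ : Fin N => P
  have hint : Integrable (fun z : Fin N → Z => ∏ i, Real.exp (g (z i))) μ :=
    Integrable.fintype_prod fun _ => hi
  have h1 := mul_meas_ge_le_integral_of_nonneg
    (Filter.Eventually.of_forall fun z => Finset.prod_nonneg fun i _ => (Real.exp_pos (g (z i))).le)
    hint (Real.exp (s + N * b))
  have h2 : ∫ z : Fin N → Z, ∏ i, Real.exp (g (z i)) ∂μ ≤ Real.exp (N * b) := by
    rw [integral_fintype_prod_eq_prod (fun _ z => Real.exp (g z)), Finset.prod_const,
      Finset.card_univ, Fintype.card_fin, Real.exp_nat_mul]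
    exact pow_le_pow_left₀ (integral_nonneg fun z => (Real.exp_pos _).le) hb N
  have h3 : {z : Fin N → Z | s + N * b ≤ ∑ i, g (z i)} =
      {z | Real.exp (s + N * b) ≤ ∏ i, Real.exp (g (z i))} := by
    ext z
    simp only [Set.mem_ofPred_eq, ← Real.exp_sum, Real.exp_le_exp]
  rw [h3, ← ofReal_measureReal]
  refine ENNReal.ofReal_le_ofReal ?_
  rw [Real.exp_neg, ← one_div, le_div_iff₀ (Real.exp_pos _)]
  refine le_of_mul_le_mul_left (a := Real.exp (N * b)) ?_ (Real.exp_pos _)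
  rw [Real.exp_add] at h1 ⊢
  linarith

/-- Relative deviations of the empirical mean under a Bernstein condition. -/
theorem measure_relative_deviation_le {g : Z → ℝ} (hg : Measurable g) (hB : ∀ z, |g z| ≤ B)
    {l κ : ℝ} (hl : 0 < l) (hlB : l * B ≤ 1) (hlκ : l * κ ≤ 1 / 2) (h0 : 0 ≤ ∫ z, g z ∂P)
    (hbern : ∫ z, g z ^ 2 ∂P ≤ κ * ∫ z, g z ∂P) (N : ℕ) (s : ℝ) :
    (Measure.pi fun _ : Fin N => P)
      {z | s + N * (-l * (∫ z, g z ∂P) / 2) ≤ ∑ i, -l * g (z i) ∨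
        s + N * (3 / 2 * l * ∫ z, g z ∂P) ≤ ∑ i, l * g (z i)} ≤
      ENNReal.ofReal (2 * Real.exp (-s)) := by
  set ρ := ∫ z, g z ∂P
  have hi : ∀ c : ℝ, |c| * B ≤ 1 → Integrable (fun z => Real.exp (c * g z)) P := fun c hc =>
    (hg.const_mul c).exp.integrable_of_abs_le (C := Real.exp 1) fun z => by
      rw [abs_of_pos (Real.exp_pos _)]
      refine Real.exp_le_exp.2 ((le_abs_self _).trans ?_)
      rw [abs_mul]
      exact (mul_le_mul_of_nonneg_left (hB z) (abs_nonneg c)).trans hc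
  -- The second-order term costs at most half of the first-order one, whence the factors `1 / 2` and
  -- `3 / 2`.
  have hsq : l ^ 2 * ∫ z, g z ^ 2 ∂P ≤ l * ρ / 2 := by
    calc l ^ 2 * ∫ z, g z ^ 2 ∂P ≤ l ^ 2 * (κ * ρ) := by gcongr
      _ = l * κ * (l * ρ) := by ring
      _ ≤ 1 / 2 * (l * ρ) := by gcongr
      _ = _ := by ring
  have hl1 : |(-l)| * B ≤ 1 := by rwa [abs_neg, abs_of_pos hl]
  have hl2 : |l| * B ≤ 1 := by rwa [abs_of_pos hl]
  have h1 := measure_pi_sum_ge_le (g := fun z => -l * g z) (b := -l * ρ / 2) (hi _ hl1)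
    ((integral_exp_le hg hB hl1).trans (Real.exp_le_exp.2 (by nlinarith))) N s
  have h2 := measure_pi_sum_ge_le (g := fun z => l * g z) (b := 3 / 2 * l * ρ) (hi _ hl2)
    ((integral_exp_le hg hB hl2).trans (Real.exp_le_exp.2 (by nlinarith))) N s
  rw [two_mul, ENNReal.ofReal_add (Real.exp_pos _).le (Real.exp_pos _).le]
  exact (measure_union_le _ _).trans (add_le_add h1 h2)

/-- Boosting the confidence of a base learner `a` by minimizing an empirical mean over the outcomes
of `K` independent runs. -/
theorem measure_boost_failure_le (hY : Measurable (Function.uncurry Y))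
    (hB : ∀ h z, |Y h z| ≤ B) {κ : ℝ} (hκ : 0 < κ) (hBκ : B ≤ 2 * κ)
    (h0 : ∀ h, 0 ≤ ∫ z, Y h z ∂P) (hbern : ∀ h, ∫ z, Y h z ^ 2 ∂P ≤ κ * ∫ z, Y h z ∂P)
    {m : ℕ} {a : (Fin m → Z) → H} (ha : Measurable a) {ε : ℝ} (hε : 0 < ε)
    (hle : ∫ S, ∫ z, Y (a S) z ∂P ∂(Measure.pi fun _ : Fin m => P) ≤ ε) (K : ℕ) {N : ℕ}
    (hN : 0 < N) (s : ℝ) :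
    ((Measure.pi fun _ : Fin K => Measure.pi fun _ : Fin m => P).prod
      (Measure.pi fun _ : Fin N => P))
      {p | ∃ k, (∀ k', ∑ i, Y (a (p.1 k)) (p.2 i) ≤ ∑ i, Y (a (p.1 k')) (p.2 i)) ∧
        3 * (Real.exp 1 * ε) + 8 * κ * s / N < ∫ z, Y (a (p.1 k)) z ∂P} ≤
      ENNReal.ofReal (Real.exp (-K) + 2 * K * Real.exp (-s)) := by
  have hmeas := measurable_integral_right (P := P) hY
  set ρ : H → ℝ := fun h => ∫ z, Y h z ∂P with hρ
  -- This is the largest scale with `l * κ ≤ 1 / 2`; `B ≤ 2 * κ` then gives `l * B ≤ 1`.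
  set l := 1 / (2 * κ) with hl
  have hl0 : 0 < l := by positivity
  have hlB : l * B ≤ 1 := by
    rw [hl, div_mul_eq_mul_div, div_le_iff₀ (by positivity)]; linarith
  have hlκ : l * κ = 1 / 2 := by rw [hl]; field_simp
  set E₁ : Set ((Fin K → Fin m → Z) × (Fin N → Z)) :=
    {ω | ∀ k, Real.exp 1 * ε < ρ (a (ω k))} ×ˢ Set.univ with hE₁
  set D : H → Set (Fin N → Z) := fun h =>
    {z | s + N * (-l * ρ h / 2) ≤ ∑ i, -l * Y h (z i) ∨
      s + N * (3 / 2 * l * ρ h) ≤ ∑ i, l * Y h (z i)} with hD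
  set E₂ : Set ((Fin K → Fin m → Z) × (Fin N → Z)) := ⋃ k, {p | p.2 ∈ D (a (p.1 k))} with hE₂
  have hYm : ∀ (c : ℝ) (k : Fin K), Measurable fun p : (Fin K → Fin m → Z) × (Fin N → Z) =>
      ∑ i, c * Y (a (p.1 k)) (p.2 i) := fun c k =>
    Finset.measurable_sum _ fun i _ => (hY.comp
      ((ha.comp ((measurable_pi_apply k).comp measurable_fst)).prodMk
        ((measurable_pi_apply i).comp measurable_snd))).const_mul c
  have hρm : ∀ k : Fin K, Measurable fun p : (Fin K → Fin m → Z) × (Fin N → Z) =>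
      ρ (a (p.1 k)) := fun k =>
    hmeas.comp (ha.comp ((measurable_pi_apply k).comp measurable_fst))
  have hE₂m : ∀ k, MeasurableSet {p : (Fin K → Fin m → Z) × (Fin N → Z) |
      p.2 ∈ D (a (p.1 k))} := fun k =>
    (measurableSet_le (((((hρm k).const_mul (-l)).div_const 2).const_mul _).const_add s)
      (hYm _ k)).union
    (measurableSet_le ((((hρm k).const_mul (3 / 2 * l)).const_mul _).const_add s) (hYm _ k))
  have hsub : {p : (Fin K → Fin m → Z) × (Fin N → Z) |
      ∃ k, (∀ k', ∑ i, Y (a (p.1 k)) (p.2 i) ≤ ∑ i, Y (a (p.1 k')) (p.2 i)) ∧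
        3 * (Real.exp 1 * ε) + 8 * κ * s / N < ρ (a (p.1 k))} ⊆ E₁ ∪ E₂ := by
    -- Off `E₁` some run `k₀` is good. Off `E₂`, `N * l * ρ / 2 - s` at `k` is below the scaled
    -- empirical sum at `k`, which is at most the one at `k₀`, itself below `s + 3 / 2 * N * l * ρ`
    -- at `k₀`.
    rintro p ⟨k, hk, hlt⟩
    by_contra hp
    simp only [hE₁, hE₂, hD, Set.mem_union, Set.mem_prod, Set.mem_ofPred_eq, Set.mem_univ, and_true,
      Set.mem_iUnion, not_or, not_forall, not_exists, not_lt, not_le, ← Finset.mul_sum] at hp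
    obtain ⟨⟨k₀, hk₀⟩, hp2⟩ := hp
    have h1 := (hp2 k).1
    have h2 := (hp2 k₀).2
    have h3 := mul_le_mul_of_nonneg_left (hk k₀) hl0.le
    have h4 : N * l * ρ (a (p.1 k)) < 4 * s + N * l * (3 * ρ (a (p.1 k₀))) := by linarith
    have hNl : (0 : ℝ) < N * l := by positivity
    have h5 : N * l * ρ (a (p.1 k)) < N * l * (3 * (Real.exp 1 * ε) + 8 * κ * s / N) := by
      have h6 : N * l * (8 * κ * s / N) = 4 * s := by
        rw [hl]; field_simp; ring
      have h7 := mul_le_mul_of_nonneg_left hk₀ hNl.le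
      rw [mul_add, h6]
      linarith
    exact absurd (lt_of_mul_lt_mul_left h5 hNl.le) hlt.le.not_gt
  refine (measure_mono hsub).trans ((measure_union_le _ _).trans ?_)
  rw [ENNReal.ofReal_add (Real.exp_pos _).le (by positivity)]
  refine add_le_add ?_ ?_
  · rw [hE₁, Measure.prod_prod, measure_univ, mul_one]
    have hρB : ∀ S, |ρ (a S)| ≤ B := fun S => by
      have := norm_integral_le_of_norm_le_const (μ := P) (f := Y (a S)) (C := B)
        (Filter.Eventually.of_forall fun z => hB (a S) z)
      simpa using this
    exact measure_forall_lt_le (ρ := fun S => ρ (a S)) ((hmeas.comp ha).integrable_of_abs_le hρB)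
      (fun S => h0 _) hε hle K
  · refine (measure_iUnion_le _).trans ?_
    rw [tsum_fintype]
    calc _ ≤ ∑ _ : Fin K, ENNReal.ofReal (2 * Real.exp (-s)) := by
          refine Finset.sum_le_sum fun k _ => ?_
          -- Given the first-phase samples, the hypothesis is fixed and the second sample is still
          -- i.i.d.
          rw [Measure.prod_apply (hE₂m k)]
          calc _ ≤ ∫⁻ _, ENNReal.ofReal (2 * Real.exp (-s))
                ∂(Measure.pi fun _ : Fin K => Measure.pi fun _ : Fin m => P) :=
                lintegral_mono fun ω => measure_relative_deviation_le
                  (hY.comp measurable_prodMk_left) (hB (a (ω k))) hl0 hlB hlκ.le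
                  (h0 _) (hbern _) N s
            _ = _ := by simp
      _ = _ := by
          rw [Finset.sum_const, Finset.card_univ, Fintype.card_fin, nsmul_eq_mul,
            ← ENNReal.ofReal_natCast, ← ENNReal.ofReal_mul (by positivity)]
          congr 1; ring

end Expectation

/-! ### The Bernstein condition -/

theorem exp_min_sq_abs_le_cosh (s : ℝ) : Real.exp (min (s ^ 2) |s| / 4) ≤ Real.cosh s := by
  rcases le_or_gt |s| 1 with h | h
  · have h1 : s ^ 2 ≤ 1 := (sq_le_one_iff_abs_le_one s).2 h
    have h2 : |s ^ 2 / 4| ≤ 1 := by rw [abs_of_nonneg (by positivity)]; linarith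
    have h3 := le_of_abs_le (Real.abs_exp_sub_one_sub_id_le h2)
    calc _ ≤ Real.exp (s ^ 2 / 4) := Real.exp_le_exp.2 (by gcongr; exact min_le_left _ _)
      _ ≤ 1 + s ^ 2 / 2 := by nlinarith [sq_nonneg s]
      _ ≤ Real.cosh |s| := by
        have h4 := Real.self_le_sinh_iff.2 (show 0 ≤ |s| / 2 by positivity)
        have h5 : Real.cosh |s| = 1 + 2 * Real.sinh (|s| / 2) ^ 2 := by
          rw [← mul_div_cancel₀ |s| two_ne_zero, Real.cosh_two_mul, Real.cosh_sq]
          ring_nf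
        have h6 := pow_le_pow_left₀ (by positivity) h4 2
        rw [div_pow, sq_abs] at h6
        linarith
      _ = _ := Real.cosh_abs s
  · rw [← Real.cosh_abs, Real.cosh_eq, le_div_iff₀ two_pos]
    have h1 := Real.quadratic_le_exp_of_nonneg (x := 3 / 4 * |s|) (by positivity)
    have h2 : 2 ≤ Real.exp (3 / 4 * |s|) := by nlinarith
    calc _ ≤ Real.exp (|s| / 4) * Real.exp (3 / 4 * |s|) := by
          gcongr; exact min_le_right _ _
      _ = Real.exp |s| := by rw [← Real.exp_add]; ring_nf
      _ ≤ _ := by linarith [Real.exp_pos (-|s|)]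

/-- The endpoint values of `exp (-η * g)` average to the exponential at the mean of `g` times `cosh
(η * y / 2)`, and this `cosh` is the gain. The diameter makes its linear regime quadratic, since
`|y| ≥ y ^ 2 / B`; this is the `4 * B` in the constant. -/
theorem ExpConcaveOn.midpoint_le {d : ℕ} {F : Set (Vec d)} {g : Vec d → ℝ} {η B : ℝ} (hη : 0 < η)
    (hc : ExpConcaveOn F η g) (hB : HasDiameter F g B) {w w' : Vec d} (hw : w ∈ F)
    (hw' : w' ∈ F) :
    g ((1 / 2 : ℝ) • w + (1 / 2 : ℝ) • w') ≤
      1 / 2 * (g w + g w') - (g w' - g w) ^ 2 / (2 * (8 / η + 4 * B)) := by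
  have hB1 := hB _ hw' _ hw
  have hB0 : 0 ≤ B := (abs_nonneg _).trans hB1
  have h1 := hc.2 hw hw' (by norm_num : (0 : ℝ) ≤ 1 / 2) (by norm_num : (0 : ℝ) ≤ 1 / 2)
    (by norm_num)
  set y := g w' - g w with hy
  have h2 := exp_min_sq_abs_le_cosh (η * y / 2)
  have h3 : (1 / 2 : ℝ) • Real.exp (-η * g w) + (1 / 2 : ℝ) • Real.exp (-η * g w') =
      Real.exp (-η * (g w + g w') / 2) * Real.cosh (η * y / 2) := by
    rw [Real.cosh_eq, mul_div_assoc', mul_add, ← Real.exp_add, ← Real.exp_add, hy]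
    simp only [smul_eq_mul]
    ring_nf
  rw [h3] at h1
  have h4 : Real.exp (-η * (g w + g w') / 2 + min ((η * y / 2) ^ 2) |η * y / 2| / 4) ≤
      Real.exp (-η * g ((1 / 2 : ℝ) • w + (1 / 2 : ℝ) • w')) := by
    rw [Real.exp_add]
    exact (mul_le_mul_of_nonneg_left h2 (Real.exp_pos _).le).trans h1
  rw [Real.exp_le_exp] at h4
  have h5 : η * (y ^ 2 / (2 * (8 / η + 4 * B))) ≤ min ((η * y / 2) ^ 2) |η * y / 2| / 4 := by
    have h6 : η * (y ^ 2 / (2 * (8 / η + 4 * B))) = η ^ 2 * y ^ 2 / (16 + 8 * (η * B)) := by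
      have : 8 / η + 4 * B ≠ 0 := by positivity
      have : 16 + 8 * (η * B) ≠ 0 := by positivity
      field_simp
      ring
    have h7 : 0 ≤ η * B := by positivity
    rw [h6, div_le_iff₀ (by positivity)]
    rcases min_choice ((η * y / 2) ^ 2) |η * y / 2| with h | h
    · rw [h]
      have h8 : 0 ≤ η ^ 2 * y ^ 2 * (η * B) := by positivity
      nlinarith
    · rw [h, abs_div, abs_mul, abs_of_pos hη, abs_two, ← sq_abs y]
      have h8 : η * |y| * (η * |y|) ≤ η * |y| * (η * B) := by gcongr
      have h9 : 0 ≤ η * |y| := by positivity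
      nlinarith
  refine le_of_mul_le_mul_left (a := η) ?_ hη
  linarith

/-- The midpoint of `f₀` and `f` lies in `F`, so its risk is at least that of `f₀`. In the
integrated midpoint inequality the quadratic gain is then at most half the excess risk of `f`. -/
theorem IsRiskMinimizer.bernstein {d : ℕ} {Z : Type*} [MeasurableSpace Z] {P : Measure Z}
    {ℓ : Vec d → Z → ℝ} {F : Set (Vec d)} {f₀ f : Vec d} (hf₀ : IsRiskMinimizer P ℓ F f₀)
    (hF : Convex ℝ F) (hf : f ∈ F) {κ : ℝ} (hκ : 0 < κ)
    (hsq : Integrable (fun z => (ℓ f z - ℓ f₀ z) ^ 2) P)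
    (hmid : ∀ z, ℓ ((1 / 2 : ℝ) • f₀ + (1 / 2 : ℝ) • f) z ≤
      1 / 2 * (ℓ f₀ z + ℓ f z) - (ℓ f z - ℓ f₀ z) ^ 2 / (2 * κ)) :
    ∫ z, (ℓ f z - ℓ f₀ z) ^ 2 ∂P ≤ κ * ∫ z, (ℓ f z - ℓ f₀ z) ∂P := by
  have hm := midpoint_mem_of_convex hF hf₀.mem hf
  have hi₀ := hf₀.integrable _ hf₀.mem
  have hi := hf₀.integrable _ hf
  have hi1 : Integrable (fun z => 1 / 2 * (ℓ f₀ z + ℓ f z)) P := (hi₀.add hi).const_mul _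
  have h1 := integral_mono (hf₀.integrable _ hm) (hi1.sub (hsq.div_const (2 * κ))) hmid
  have h2 := hf₀.le _ hm
  have h3 : ∫ z, (1 / 2 * (ℓ f₀ z + ℓ f z) - (ℓ f z - ℓ f₀ z) ^ 2 / (2 * κ)) ∂P =
      1 / 2 * (∫ z, ℓ f₀ z ∂P + ∫ z, ℓ f z ∂P) - (∫ z, (ℓ f z - ℓ f₀ z) ^ 2 ∂P) / (2 * κ) := by
    rw [integral_sub hi1 (hsq.div_const _), integral_const_mul, integral_add hi₀ hi,
      integral_div]
  change _ ≤ ∫ z, (1 / 2 * (ℓ f₀ z + ℓ f z) - (ℓ f z - ℓ f₀ z) ^ 2 / (2 * κ)) ∂P at h1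
  rw [h3] at h1
  rw [risk, risk] at h2
  rw [integral_sub hi hi₀]
  have h4 : (∫ z, (ℓ f z - ℓ f₀ z) ^ 2 ∂P) / (2 * κ) ≤ 1 / 2 * (∫ z, ℓ f z ∂P - ∫ z, ℓ f₀ z ∂P) := by
    linarith
  rw [div_le_iff₀ (by positivity)] at h4
  linarith

/-! ### Choice of parameters and the final bounds -/

theorem numRuns_pos {δ : ℝ} (h0 : 0 < δ) (h1 : δ < 1) : 0 < numRuns δ :=
  Nat.ceil_pos.2 (Real.log_pos ((one_lt_div h0).2 (by linarith)))

theorem numRuns_le {δ : ℝ} (h0 : 0 < δ) (h1 : δ < 1) :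
    (numRuns δ : ℝ) ≤ 3 * max 1 (Real.log (1 / δ)) := by
  have h2 : (numRuns δ : ℝ) < Real.log (2 / δ) + 1 :=
    Nat.ceil_lt_add_one (Real.log_nonneg ((one_le_div h0).2 (by linarith)))
  have h3 : Real.log (2 / δ) = Real.log 2 + Real.log (1 / δ) := by
    rw [← Real.log_mul two_ne_zero (by positivity)]; ring_nf
  have h4 := Real.log_two_lt_d9
  have h5 := le_max_left 1 (Real.log (1 / δ))
  have h6 := le_max_right 1 (Real.log (1 / δ))
  linarith

theorem exp_neg_numRuns_le {δ : ℝ} (h0 : 0 < δ) : Real.exp (-(numRuns δ)) ≤ δ / 2 := by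
  rw [← Real.le_log_iff_exp_le (by positivity), ← inv_div, Real.log_inv]
  exact neg_le_neg (Nat.le_ceil _)

theorem log_four_mul_numRuns_le {δ : ℝ} (h0 : 0 < δ) (h1 : δ < 1) :
    Real.log (4 * numRuns δ / δ) ≤ 6 * max 1 (Real.log (1 / δ)) := by
  have hK : (0 : ℝ) < numRuns δ := by exact_mod_cast numRuns_pos h0 h1
  have h3 : Real.log (4 * numRuns δ / δ) =
      2 * Real.log 2 + Real.log (numRuns δ) + Real.log (1 / δ) := by
    have h : (4 : ℝ) = 2 ^ 2 := by norm_num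
    rw [mul_div_assoc, div_eq_mul_one_div, ← mul_assoc, Real.log_mul (by positivity) (by positivity),
      Real.log_mul (by positivity) (by positivity), h, Real.log_pow]
    norm_num
  have h4 := Real.log_two_lt_d9
  have h5 := le_max_left 1 (Real.log (1 / δ))
  have h6 := le_max_right 1 (Real.log (1 / δ))
  have h7 := Real.log_le_sub_one_of_pos hK
  have h8 := numRuns_le h0 h1
  linarith

/-- ConfidenceBoost for a base learner whose leave-one-out regret is at most `M` and a loss with the
Bernstein condition with constant `κ`. -/
theorem boostFailureProb_le {d : ℕ} {Z : Type*} [MeasurableSpace Z] {P : Measure Z}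
    [IsProbabilityMeasure P] {F : Set (Vec d)} {ℓ : Vec d → Z → ℝ} {B : ℝ}
    {A : Learner d Z} {f₀ : Vec d} {δ : ℝ} {n : ℕ} (hF : Convex ℝ F)
    (hmeas : ∀ f ∈ F, Measurable (ℓ f)) (hcont : ∀ z, ContinuousOn (fun f => ℓ f z) F)
    (hB : ∀ z, HasDiameter F (fun f => ℓ f z) B) (hAF : ∀ m z, A m z ∈ F)
    (hA : ∀ m, Measurable (A m)) (hf₀ : IsRiskMinimizer P ℓ F f₀) {M : ℝ} (hM0 : 0 < M)
    (hM : ∀ m, 0 < m → ∀ z : Fin (m + 1) → Z,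
      ∑ j, (ℓ (A m fun i => z (j.succAbove i)) (z j) - ℓ f₀ (z j)) ≤ M)
    {κ : ℝ} (hκ : 0 < κ) (hBκ : B ≤ 2 * κ)
    (hmid : ∀ f ∈ F, ∀ z, ℓ ((1 / 2 : ℝ) • f₀ + (1 / 2 : ℝ) • f) z ≤
      1 / 2 * (ℓ f₀ z + ℓ f z) - (ℓ f z - ℓ f₀ z) ^ 2 / (2 * κ))
    (hδ0 : 0 < δ) (hδ1 : δ < 1) (hn : 0 < n) (hdvd : 2 * numRuns δ ∣ n) {r : ℝ}
    (hr : max 1 (Real.log (1 / δ)) / n * (54 * M + 96 * κ) ≤ r) :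
    boostFailureProb P ℓ A (numRuns δ) (n / (2 * numRuns δ)) (n / 2) f₀ r ≤ ENNReal.ofReal δ := by
  set K := numRuns δ with hK
  have hK0 : 0 < K := numRuns_pos hδ0 hδ1
  obtain ⟨q, rfl⟩ := hdvd
  have hq : 0 < q := Nat.pos_of_mul_pos_left hn
  have hN1 : 2 * K * q / (2 * K) = q := Nat.mul_div_cancel_left q (by positivity)
  have hN2 : 2 * K * q / 2 = K * q := by rw [mul_assoc, Nat.mul_div_cancel_left _ two_pos]
  rw [hN1, hN2]
  have hKq : 0 < K * q := by positivity
  let Y : F → Z → ℝ := fun f z => ℓ f z - ℓ f₀ z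
  have hYm : ∀ f : F, Measurable (Y f) := fun f => (hmeas f f.2).sub (hmeas f₀ hf₀.mem)
  have hYB : ∀ (f : F) z, |Y f z| ≤ B := fun f z => hB z f f.2 f₀ hf₀.mem
  -- Joint measurability holds because `Y` is a Carathéodory function: continuous in the hypothesis,
  -- measurable in the outcome.
  have hY : Measurable (Function.uncurry Y) :=
    measurable_uncurry_of_continuous_of_measurable
      (fun z => (continuousOn_iff_continuous_domRestrict.1 (hcont z)).sub continuous_const) hYm
  have hρ : ∀ f : F, ∫ z, Y f z ∂P = risk P ℓ f - risk P ℓ f₀ := fun f =>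
    integral_sub (hf₀.integrable f f.2) (hf₀.integrable f₀ hf₀.mem)
  have hbern : ∀ f : F, ∫ z, Y f z ^ 2 ∂P ≤ κ * ∫ z, Y f z ∂P := fun f =>
    hf₀.bernstein hF f.2 hκ (((hYm f).pow_const 2).integrable_of_abs_le (C := B ^ 2) fun z => by
      rw [abs_pow]; exact pow_le_pow_left₀ (abs_nonneg _) (hYB f z) 2) (hmid f f.2)
  let a : (Fin q → Z) → F := fun z => ⟨A q z, hAF q z⟩
  have ha : Measurable a := (hA q).subtype_mk
  -- This makes `2 * K * exp (-s) = δ / 2`; the other `δ / 2` covers the event that all runs are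
  -- bad.
  set s := Real.log (4 * K / δ) with hs
  have hmain := measure_boost_failure_le hY hYB hκ hBκ
    (fun f => by rw [hρ]; exact sub_nonneg.2 (hf₀.le f f.2)) hbern ha
    (ε := M / (q + 1)) (by positivity)
    (integral_integral_le_of_leaveOneOut (P := P) hY hYB ha (hM q hq)) K hKq s
  have hprob : Real.exp (-K) + 2 * K * Real.exp (-s) ≤ δ := by
    have h1 : Real.exp (-K) ≤ δ / 2 := exp_neg_numRuns_le hδ0
    have h2 : Real.exp (-s) = δ / (4 * K) := by
      rw [Real.exp_neg, Real.exp_log (by positivity), inv_div]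
    have h3 : 2 * K * (δ / (4 * K)) = δ / 2 := by field_simp; norm_num
    rw [h2, h3]
    linarith
  refine le_trans (measure_mono ?_) (hmain.trans (ENNReal.ofReal_le_ofReal hprob))
  rintro p ⟨f, ⟨⟨k, rfl⟩, hmin⟩, hlt⟩
  refine ⟨k, fun k' => ?_, ?_⟩
  · have h1 := hmin _ ⟨k', rfl⟩
    have h2 : ∑ i, ℓ (A q (p.1 k)) (p.2 i) ≤ ∑ i, ℓ (A q (p.1 k')) (p.2 i) :=
      le_of_mul_le_mul_left h1 (by positivity)
    simp only [Y, a, Finset.sum_sub_distrib]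
    linarith
  · rw [hρ]
    refine lt_of_le_of_lt (le_trans ?_ hr) hlt
    have hΛ : 0 < max 1 (Real.log (1 / δ)) := by positivity
    have hKΛ : (K : ℝ) ≤ 3 * max 1 (Real.log (1 / δ)) := numRuns_le hδ0 hδ1
    have hsΛ : s ≤ 6 * max 1 (Real.log (1 / δ)) := log_four_mul_numRuns_le hδ0 hδ1
    set Λ := max 1 (Real.log (1 / δ))
    have hq' : (0 : ℝ) < q := by exact_mod_cast hq
    have hK' : (0 : ℝ) < K := by exact_mod_cast hK0
    have he := Real.exp_one_lt_d9
    -- With `n = 2 * K * q` and `K ≤ 3 * Λ`, `9 * M / q` is at most `54 * M * Λ / n`; with `s ≤ 6 *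
    -- Λ`, the deviation term is at most `96 * κ * Λ / n`.
    have h1 : 3 * (Real.exp 1 * (M / (q + 1))) ≤ 9 * (M / q) := by
      have : M / (q + 1) ≤ M / q := by gcongr; linarith
      have h0 : 0 ≤ M / (q + 1) := by positivity
      nlinarith
    have h2 : 9 * (M / q) ≤ Λ / (2 * K * q) * (54 * M) := by
      rw [mul_div_assoc', div_mul_eq_mul_div, div_le_div_iff₀ hq' (by positivity)]
      have : 9 * M * (2 * q) * K ≤ 9 * M * (2 * q) * (3 * Λ) := by gcongr
      linarith
    have h3 : 8 * κ * s / (K * q) ≤ Λ / (2 * K * q) * (96 * κ) := by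
      rw [div_mul_eq_mul_div, div_le_div_iff₀ (by positivity) (by positivity)]
      have : 8 * κ * (2 * K * q) * s ≤ 8 * κ * (2 * K * q) * (6 * Λ) := by gcongr
      linarith
    push_cast
    rw [mul_add]
    linarith

/-- Dimension zero is treated apart: the final bounds absorb `1 / η` into multiples of `d / η`,
which needs `d ≥ 1`. -/
theorem boostFailureProb_eq_zero_of_subsingleton {d : ℕ} (hd : d = 0) {Z : Type*}
    [MeasurableSpace Z] {P : Measure Z} {ℓ : Vec d → Z → ℝ} {A : Learner d Z} {f₀ : Vec d}
    {K nI nII : ℕ} {r : ℝ} (hr : 0 ≤ r) : boostFailureProb P ℓ A K nI nII f₀ r = 0 := by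
  subst hd
  have : {s : (Fin K → Fin nI → Z) × (Fin nII → Z) |
      ∃ f ∈ confidenceBoost ℓ A s.1 s.2, r < risk P ℓ f - risk P ℓ f₀} = ∅ := by
    refine Set.eq_empty_of_forall_notMem fun s hs => ?_
    obtain ⟨f, -, hlt⟩ := hs
    rw [Subsingleton.elim f f₀, sub_self] at hlt
    exact hlt.not_ge hr
  rw [boostFailureProb, this, measure_empty]

theorem mainTheorem2 :
    (∃ C : ℝ, 0 < C ∧
      ∀ (d : ℕ) (Z : Type*) [MeasurableSpace Z] (P : Measure Z) [IsProbabilityMeasure P]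
        (F : Set (Vec d)) (ℓ : Vec d → Z → ℝ) (Γ : Vec d → ℝ) (η β B R : ℝ)
        (A : Learner d Z) (f₀ : Vec d) (δ : ℝ) (n : ℕ),
        Convex ℝ F →
        (∀ f ∈ F, Measurable (ℓ f)) →
        0 < η → (∀ z, ExpConcaveOn F η fun f => ℓ f z) →
        (∀ z, HasDiameter F (fun f => ℓ f z) B) →
        1 ≤ β → (∀ z, SmoothOver F β fun f => ℓ f z) →
        StrongConvexOn F 1 Γ → HasDiameter F Γ R →
        IsPenalizedERM ℓ Γ F A → (∀ m, Measurable (A m)) →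
        IsRiskMinimizer P ℓ F f₀ →
        0 < δ → δ < 1 → 0 < n → 2 * numRuns δ ∣ n →
        boostFailureProb P ℓ A (numRuns δ) (n / (2 * numRuns δ)) (n / 2) f₀
            (C * (max 1 (Real.log (1 / δ)) / n * (d * β / η + d * B + R)))
          ≤ ENNReal.ofReal δ) ∧
    (∃ C : ℝ, 0 < C ∧
      ∀ (d : ℕ) (Y : Type*) [MeasurableSpace Y] (S : Set (Vec d × Y)) (P : Measure S)
        [IsProbabilityMeasure P] (F : Set (Vec d)) (φ : Y → ℝ → ℝ) (α : ℝ) (L : ℝ≥0) (η B : ℝ)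
        (A : Learner d S) (f₀ : Vec d) (δ : ℝ) (n : ℕ),
        Convex ℝ F →
        (∀ f ∈ F, Measurable (linearLoss φ f : S → ℝ)) →
        0 < α → (∀ z : S, StrongConvexOn (predictions F z.1.1) α (φ z.1.2)) →
        0 < L → (∀ z : S, LipschitzOnWith L (φ z.1.2) (predictions F z.1.1)) →
        η = α / (L : ℝ) ^ 2 →
        (∀ z : S, HasDiameter F (fun f => linearLoss φ f z) B) →
        IsERM (linearLoss φ) F A → (∀ m, Measurable (A m)) →
        IsRiskMinimizer P (linearLoss φ) F f₀ →
        0 < δ → δ < 1 → 0 < n → 2 * numRuns δ ∣ n →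
        boostFailureProb P (linearLoss φ) A (numRuns δ) (n / (2 * numRuns δ)) (n / 2) f₀
            (C * (max 1 (Real.log (1 / δ)) / n * (d / η + B)))
          ≤ ENNReal.ofReal δ) := by
  constructor
  -- The largest coefficient is that of `d * β / η`, namely `54 * 48 + 96 * 8 = 3360`.
  · refine ⟨3500, by norm_num, ?_⟩
    intro d Z _ P _ F ℓ Γ η β B R A f₀ δ n hF hmeas hη hexp hB hβ hsmooth hΓ hR hA hAm hf₀ hδ0 hδ1
      hn hdvd
    have hZ : Nonempty Z := nonempty_of_isProbabilityMeasure P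
    have hB0 : 0 ≤ B := (abs_nonneg _).trans (hB hZ.some _ hf₀.mem _ hf₀.mem)
    have hR0 : 0 ≤ R := (abs_nonneg _).trans (hR _ hf₀.mem _ hf₀.mem)
    have hβ0 : 0 ≤ β := zero_le_one.trans hβ
    rcases Nat.eq_zero_or_pos d with hd | hd
    · exact (boostFailureProb_eq_zero_of_subsingleton hd (by positivity)).trans_le zero_le
    have hd1 : (1 : ℝ) ≤ d := by exact_mod_cast hd
    refine boostFailureProb_le (M := 48 * d * β / η + 18 * d * B + R) (κ := 8 / η + 4 * B) hF hmeas
      (fun z f hf => ?_) hB (fun m z => (hA m z).1) hAm hf₀ (by positivity)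
      (fun m hm z => hA.leaveOneOut_regret_le hη hβ hexp hB hsmooth hΓ hR hm z hf₀.mem)
      (by positivity) ?_ (fun f hf z => (hexp z).midpoint_le hη (hB z) hf₀.mem hf) hδ0 hδ1 hn hdvd ?_
    · obtain ⟨g', hg', -⟩ := hsmooth z
      exact (hg' f hf).hasFDerivWithinAt.continuousWithinAt
    · have : 0 ≤ 8 / η := by positivity
      linarith
    · rw [mul_left_comm 3500]
      refine mul_le_mul_of_nonneg_left ?_ (by positivity)
      have h1 : 1 / η ≤ d * β / η := by
        gcongr; nlinarith
      have h2 : B ≤ d * B := by nlinarith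
      have h3 : 48 * d * β / η = 48 * (d * β / η) := by ring
      have h4 : 8 / η = 8 * (1 / η) := by ring
      have h5 : 0 ≤ d * β / η := by positivity
      rw [h3, h4]
      linarith
  -- The coefficient of `d / η` is `54 * 4 + 96 * 4 = 600`.
  · refine ⟨700, by norm_num, ?_⟩
    intro d Y _ S P _ F φ α L η B A f₀ δ n hF hmeas hα hsc hL hLip hη hB hA hAm hf₀ hδ0 hδ1 hn hdvd
    have hS : Nonempty S := nonempty_of_isProbabilityMeasure P
    have hB0 : 0 ≤ B := (abs_nonneg _).trans (hB hS.some _ hf₀.mem _ hf₀.mem)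
    have hL' : (0 : ℝ) < L := hL
    have hη0 : 0 < η := by rw [hη]; positivity
    have hηinv : (L : ℝ) ^ 2 / α = 1 / η := by rw [hη, one_div_div]
    rcases Nat.eq_zero_or_pos d with hd | hd
    · exact (boostFailureProb_eq_zero_of_subsingleton hd (by positivity)).trans_le zero_le
    have hd1 : (1 : ℝ) ≤ d := by exact_mod_cast hd
    -- The part `4 / η` of `κ` already gives the midpoint inequality; `B` is added only to secure `B
    -- ≤ 2 * κ`.
    refine boostFailureProb_le (M := 4 * d * (L ^ 2 / α)) (κ := 4 / η + B) hF hmeas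
      (fun z => (hLip z).continuousOn.comp (by fun_prop) (Set.mapsTo_image _ F)) hB
      (fun m z => (hA m z).1) hAm hf₀ (by positivity)
      (fun m hm z => hA.leaveOneOut_regret_le hF hα hsc hLip hm z hf₀.mem)
      (by positivity) ?_ (fun f hf z => ?_) hδ0 hδ1 hn hdvd ?_
    · have : 0 ≤ 4 / η := by positivity
      linarith
    · refine (linearLoss_midpoint_le (hsc z) hf₀.mem hf).trans (sub_le_sub_left ?_ _)
      have h1 := linearLoss_sub_sq_le (hLip z) hf₀.mem hf
      calc _ ≤ (linearLoss φ f z - linearLoss φ f₀ z) ^ 2 / (2 * (4 / η)) := by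
            gcongr; linarith
        _ ≤ L ^ 2 * ⟪z.1.1, f - f₀⟫ ^ 2 / (2 * (4 / η)) := by gcongr
        _ = _ := by rw [hη]; field_simp; ring
    · rw [mul_left_comm 700]
      refine mul_le_mul_of_nonneg_left ?_ (by positivity)
      have h1 : 1 / η ≤ d / η := by gcongr
      have h3 : 4 / η = 4 * (1 / η) := by ring
      have h4 : (d : ℝ) * (1 / η) = d / η := by ring
      have h5 : 0 ≤ d / η := by positivity
      rw [hηinv, h3]
      linarith
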